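/- Let $x=(x^1,\dots,x^n)$ be independent variables, $u=(u^1,\dots,u^m)$ dependent variables with derivatives $u_{(1)}=\{u^\alpha_i\}$, $u_{(2)}=\{u^\alpha_{ij}\},\dots$, and let $D_i=\frac{\partial}{\partial x^i}+u^\alpha_i\frac{\partial}{\partial u^\alpha}+u^\alpha_{ij}\frac{\partial}{\partial u^\alpha_j}+\cdots$ be the total differentiations, extended in the same way to any further dependent variables. Summation over repeated indices is understood. A differential function is a real function of finitely many of the variables $x$, dependent variables and their derivatives, defined on an open set, of class $C^r$, where $r\in\{\infty,\omega\}$ is fixed ($C^\omega$ means locally analytic). Solutions are functions of class $C^r$ on open subsets of $\mathbb R^n$ whose derivatives lie in the domains of the functions considered. Consider a system of $\overline m$ differential equations, $\overline m$ arbitrary, $$F_{\bar\alpha}(x,u,u_{(1)},\dots,u_{(s)})=0,\qquad \bar\alpha=1,\dots,\overline m, \tag{1}$$ where the $F_{\bar\alpha}$ are differential functions, and its formal Lagrangian $\mathcal L=v^{\bar\beta}F_{\bar\beta}$, where $v=(v^1,\dots,v^{\overline m})$ are new dependent variables. Put $$\frac{\delta}{\delta u^\alpha_{i_1\cdots i_k}}=\frac{\partial}{\partial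 u^\alpha_{i_1\cdots i_k}}+\sum_{t\ge1}(-1)^tD_{j_1}\cdots D_{j_t}\frac{\partial}{\partial u^\alpha_{i_1\cdots i_kj_1\cdots j_t}},\qquad k\ge 0,$$ where the functions to be differentiated are written in the symmetric form with respect to all mixed derivatives $u^\alpha_{ij},u^\alpha_{ijk},\dots$ (for instance $u_{xy}=\tfrac12u_{xy}+\tfrac12u_{yx}$). Suppose that (1) is nonlinearly self-adjoint: there is a substitution $v^{\bar\alpha}=\varphi^{\bar\alpha}(x,u)$, with $\varphi$ of class $C^r$ and not identically zero, such that the adjoint equations $$\frac{\delta(v^{\bar\beta}F_{\bar\beta})}{\delta u^\alpha}=0,\qquad \alpha=1,\dots,m,$$ are satisfied for all solutions $u$ of (1) upon setting $v^{\bar\alpha}=\varphi^{\bar\alpha}(x,u)$, $v^{\bar\alpha}_{i_1\cdots i_k}=D_{i_1}\cdots D_{i_k}(\varphi^{\bar\alpha}(x,u))$. Let $$X=\xi^i\frac{\partial}{\partial x^i}+\eta^\alpha\frac{\partial}{\partial u^\alpha}$$ be a symmetry of (1) of one of the following kinds. (a) Lie point, contact or Lie–Bäcklund symmetry: $\xi^i,\eta^\alpha$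 are differential functions of $x,u,u_{(1)},\dots$. (b) Nonlocal symmetry: $\xi^i,\eta^\alpha$ are differential functions of $x$, $u$, nonlocal variables $w$ and derivatives of $u$ and $w$, where the nonlocal variables $w=(w^k)$ are further dependent variables determined by a system of differential equations $G_b(x,u,w,u_{(1)},w_{(1)},\dots)=0$, which is then adjoined to (1). Here $X$ is a symmetry of (1) if, with $W^\alpha=\eta^\alpha-\xi^ju^\alpha_j$ and the prolongation $\zeta^\alpha_{i_1\cdots i_k}=D_{i_1}\cdots D_{i_k}(W^\alpha)+\xi^ju^\alpha_{ji_1\cdots i_k}$, $$X(F_{\bar\alpha})=\xi^i\frac{\partial F_{\bar\alpha}}{\partial x^i}+\eta^\alpha\frac{\partial F_{\bar\alpha}}{\partial u^\alpha}+\zeta^\alpha_i\frac{\partial F_{\bar\alpha}}{\partial u^\alpha_i}+\zeta^\alpha_{i_1i_2}\frac{\partial F_{\bar\alpha}}{\partial u^\alpha_{i_1i_2}}+\cdots=0$$ for every $\bar\alpha$ on the solutions of (1) (in case (b), on the solutions of (1) together with $G_b=0$). Then $$C^i=\xi^i\mathcal L+W^\alpha\frac{\delta\mathcal L}{\delta u^\alpha_i}+\sum_{k\ge1}D_{j_1}\cdots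 D_{j_k}(W^\alpha)\,\frac{\delta\mathcal L}{\delta u^\alpha_{ij_1\cdots j_k}},\qquad i=1,\dots,n,$$ that is, $$C^i=\xi^i\mathcal L+W^\alpha\Big[\frac{\partial\mathcal L}{\partial u^\alpha_i}-D_j\Big(\frac{\partial\mathcal L}{\partial u^\alpha_{ij}}\Big)+D_jD_k\Big(\frac{\partial\mathcal L}{\partial u^\alpha_{ijk}}\Big)-\cdots\Big]+D_j(W^\alpha)\Big[\frac{\partial\mathcal L}{\partial u^\alpha_{ij}}-D_k\Big(\frac{\partial\mathcal L}{\partial u^\alpha_{ijk}}\Big)+\cdots\Big]+D_jD_k(W^\alpha)\Big[\frac{\partial\mathcal L}{\partial u^\alpha_{ijk}}-\cdots\Big]+\cdots,$$ with $v$ and its derivatives eliminated through $v^{\bar\alpha}=\varphi^{\bar\alpha}(x,u)$, is a conserved vector: the $C^i$ are differential functions (of $x,u,u_{(1)},\dots$, and in case (b) also of $w,w_{(1)},\dots$), and $$D_i(C^i)=0$$ on the solutions of (1) (in case (b), on the solutions of (1) together with $G_b=0$). -/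

import Mathlib

open scoped ContDiff

namespace JetCalculus

/-- Coordinates on the infinite jet space with `n` independent variables and dependent variables
indexed by `D`: the variables `x^i`, and the derivatives `u^d_J`, where the (unordered) multi-index
`J` is a multiset of independent variables. So `u^d_{ij}` and `u^d_{ji}` are one coordinate. -/
abbrev JetCoord (n : ℕ) (D : Type*) := Fin n ⊕ (D × Multiset (Fin n))

/-- The infinite jet space, with its product topology. -/
abbrev Jet (n : ℕ) (D : Type*) := JetCoord n D → ℝ

/-- The independent variable `x^i` as a coordinate. -/
abbrev cx {n : ℕ} {D : Type*} (i : Fin n) : JetCoord n D := Sum.inl i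

/-- The derivative `u^d_J` as a coordinate. -/
abbrev cu {n : ℕ} {D : Type*} (d : D) (J : Multiset (Fin n)) : JetCoord n D := Sum.inr (d, J)

/-- `f` is a differential function of class `C^r` on the open set `U` of the jet space: on `U` it is
a `C^r` function of a finite number of the variables `x, u, u_{(1)}, u_{(2)}, …`. For `r = ω` this
means locally analytic. -/
def IsDiffFun {n : ℕ} {D : Type*} (r : WithTop ℕ∞) (U : Set (Jet n D)) (f : Jet n D → ℝ) : Prop :=
  IsOpen U ∧ ∃ (S : Finset (JetCoord n D)) (g : (S → ℝ) → ℝ),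
    ∀ p ∈ U, f p = g (S.restrict p) ∧ ContDiffAt ℝ r g (S.restrict p)

open Classical in
/-- The partial derivative of a function on the jet space with respect to the coordinate `c`. -/
noncomputable def pdJet {n : ℕ} {D : Type*} (c : JetCoord n D) (f : Jet n D → ℝ) (p : Jet n D) : ℝ :=
  deriv (fun t : ℝ => f (Function.update p c t)) (p c)

/-- The total differentiation
`D_i = ∂/∂x^i + u^d_i ∂/∂u^d + u^d_{ij} ∂/∂u^d_j + ⋯` (a finite sum on differential functions). -/
noncomputable def totalD {n : ℕ} {D : Type*} (i : Fin n) (f : Jet n D → ℝ) (p : Jet n D) : ℝ :=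
  pdJet (cx i) f p + ∑ᶠ c : D × Multiset (Fin n), p (cu c.1 (i ::ₘ c.2)) * pdJet (cu c.1 c.2) f p

/-- `D_{i_1} ⋯ D_{i_s}` for a sequence `I = [i_1, …, i_s]`. -/
noncomputable def totalDs {n : ℕ} {D : Type*} (I : List (Fin n)) (f : Jet n D → ℝ) : Jet n D → ℝ :=
  I.foldr totalD f

/-- The derivative `∂f/∂u^d_{i_1 ⋯ i_s}` for a sequence `I = [i_1, …, i_s]`, with `f` written in the
symmetric form with respect to the mixed derivatives. In the symmetric form each `u^d_J` is replaced
by the mean of the `u^d_I` over the distinct orderings `I` of `J`, and the `u^d_I` are then treated as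
independent; so the derivative along `u^d_I` is that along `u^d_J` divided by the number of distinct
orderings. For instance `u_{xy} = (u_{xy} + u_{yx}) / 2` has derivative `1 / 2` for both orders. -/
noncomputable def symPd {n : ℕ} {D : Type*} (d : D) (I : List (Fin n)) (f : Jet n D → ℝ)
    (p : Jet n D) : ℝ :=
  pdJet (cu d (I : Multiset (Fin n))) f p / ((I : Multiset (Fin n)).countPerms : ℝ)

/-- The Euler–Lagrange operator with respect to the derivative `u^d_{i_1 ⋯ i_s}`, `I = [i_1, …, i_s]`,
`δ/δu^d_I = ∂/∂u^d_I + ∑_{t ≥ 1} (-1)^t D_{j_1} ⋯ D_{j_t} ∂/∂u^d_{I j_1 ⋯ j_t}`,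
the sum being over all sequences `[j_1, …, j_t]`. For `I = []` it is `δ/δu^d`. -/
noncomputable def euler {n : ℕ} {D : Type*} (d : D) (I : List (Fin n)) (f : Jet n D → ℝ)
    (p : Jet n D) : ℝ :=
  ∑ᶠ K : List (Fin n), (-1 : ℝ) ^ K.length * totalDs K (symPd d (I ++ K) f) p

/-- The partial derivative `∂g/∂x^i` of a function of `x`. -/
noncomputable def pdBase {n : ℕ} (i : Fin n) (g : (Fin n → ℝ) → ℝ) (x : Fin n → ℝ) : ℝ :=
  fderiv ℝ g x (Pi.single i 1)

/-- The jet at `x` of the functions `u^d = s d`: the values of `x` and of all the partial derivatives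
of the `u^d` at `x`. -/
noncomputable def jetOf {n : ℕ} {D : Type*} (s : D → (Fin n → ℝ) → ℝ) (x : Fin n → ℝ) : Jet n D
  | Sum.inl i => x i
  | Sum.inr (d, J) => (J.sort (· ≤ ·)).foldr pdBase (s d) x

/-- `s` is a solution of class `C^r`, on the open set `Ω`, of the system `F_b = 0`, whose jets lie in
the domain `U` on which the system is considered. -/
def IsSolution {n : ℕ} {D ι : Type*} (r : WithTop ℕ∞) (U : Set (Jet n D)) (F : ι → Jet n D → ℝ)
    (Ω : Set (Fin n → ℝ)) (s : D → (Fin n → ℝ) → ℝ) : Prop :=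
  IsOpen Ω ∧ (∀ d, ContDiffOn ℝ r (s d) Ω) ∧
    ∀ x ∈ Ω, jetOf s x ∈ U ∧ ∀ b, F b (jetOf s x) = 0

/-- The projection of jets that forgets the second group of dependent variables. -/
def fstJet {n : ℕ} {D E : Type*} (p : Jet n (D ⊕ E)) : Jet n D
  | Sum.inl i => p (cx i)
  | Sum.inr (d, J) => p (cu (Sum.inl d) J)

/-- The formal Lagrangian `𝓛 = v^β F_β`, a function of `x`, of `u` with its derivatives, and of the
new dependent variables `v`. -/
noncomputable def formalLagrangian {n m M : ℕ} (F : Fin M → Jet n (Fin m) → ℝ)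
    (p : Jet n (Fin m ⊕ Fin M)) : ℝ :=
  ∑ β, p (cu (Sum.inr β) 0) * F β (fstJet p)

/-- The function `φ(x, u)` as a function on the jet space. -/
def pointFun {n m : ℕ} (φ : (Fin n → ℝ) × (Fin m → ℝ) → ℝ) (p : Jet n (Fin m)) : ℝ :=
  φ (fun i => p (cx i), fun α => p (cu α 0))

/-- The substitution `v^β = φ^β(x, u)`, together with
`v^β_{i_1 ⋯ i_s} = D_{i_1} ⋯ D_{i_s} (φ^β(x, u))`. -/
noncomputable def substJet {n m M : ℕ} (φ : Fin M → (Fin n → ℝ) × (Fin m → ℝ) → ℝ)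
    (p : Jet n (Fin m)) : Jet n (Fin m ⊕ Fin M)
  | Sum.inl i => p (cx i)
  | Sum.inr (Sum.inl α, J) => p (cu α J)
  | Sum.inr (Sum.inr β, J) => totalDs (J.sort (· ≤ ·)) (pointFun (φ β)) p

/-- The result of eliminating `v` from a function of `x, u, v` and derivatives, via `v = φ(x, u)`. -/
noncomputable def elimV {n m M : ℕ} (φ : Fin M → (Fin n → ℝ) × (Fin m → ℝ) → ℝ)
    (f : Jet n (Fin m ⊕ Fin M) → ℝ) : Jet n (Fin m) → ℝ :=
  fun p => f (substJet φ p)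

/-- The system `F_β = 0` is nonlinearly self-adjoint, with the substitution `v = φ(x, u)`: the
function `φ` is of class `C^r` and not identically zero, and `v = φ(x, u)` satisfies the adjoint
equations `δ(v^β F_β)/δu^α = 0` for all solutions `u` of the system. -/
structure IsNonlinearlySelfAdjoint {n m M : ℕ} (r : WithTop ℕ∞) (U : Set (Jet n (Fin m)))
    (F : Fin M → Jet n (Fin m) → ℝ) (φ : Fin M → (Fin n → ℝ) × (Fin m → ℝ) → ℝ) : Prop where
  smooth : ∀ p ∈ U, ∀ β, ContDiffAt ℝ r (φ β) (fun i => p (cx i), fun α => p (cu α 0))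
  nontrivial : ∃ p ∈ U, ∃ β, pointFun (φ β) p ≠ 0
  adjoint : ∀ (Ω : Set (Fin n → ℝ)) (u : Fin m → (Fin n → ℝ) → ℝ), IsSolution r U F Ω u →
    ∀ x ∈ Ω, ∀ α, elimV φ (euler (Sum.inl α) [] (formalLagrangian F)) (jetOf u x) = 0

section Symmetry

/-! Below, the dependent variables are `u^α` and further (nonlocal) variables `w^k`, `k ∈ κ`. If `κ`
is empty, only the local variables `x, u, u_{(1)}, …` remain. -/

/-- `W^α = η^α - ξ^j u^α_j`. -/
noncomputable def charW {n m : ℕ} {κ : Type*} (ξ : Fin n → Jet n (Fin m ⊕ κ) → ℝ)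
    (η : Fin m → Jet n (Fin m ⊕ κ) → ℝ) (α : Fin m) (p : Jet n (Fin m ⊕ κ)) : ℝ :=
  η α p - ∑ j, ξ j p * p (cu (Sum.inl α) {j})

/-- The action on functions of `x, u, u_{(1)}, …` of the prolonged operator
`X = ξ^i ∂/∂x^i + η^α ∂/∂u^α + ζ^α_i ∂/∂u^α_i + ζ^α_{i_1 i_2} ∂/∂u^α_{i_1 i_2} + ⋯`, where
`ζ^α_{i_1 ⋯ i_s} = D_{i_1} ⋯ D_{i_s}(W^α) + ξ^j u^α_{j i_1 ⋯ i_s}`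
(for `s = 0` this is `η^α`). -/
noncomputable def prolong {n m : ℕ} {κ : Type*} (ξ : Fin n → Jet n (Fin m ⊕ κ) → ℝ)
    (η : Fin m → Jet n (Fin m ⊕ κ) → ℝ) (f : Jet n (Fin m) → ℝ) (p : Jet n (Fin m ⊕ κ)) : ℝ :=
  ∑ i, ξ i p * pdJet (cx i) f (fstJet p) +
    ∑ α, ∑ᶠ I : List (Fin n),
      (totalDs I (charW ξ η α) p + ∑ j, ξ j p * p (cu (Sum.inl α) (j ::ₘ (I : Multiset (Fin n))))) *
        symPd α I f (fstJet p)

/-- The equations `F_β(x, u, u_{(1)}, …) = 0` together with the differential equations `G_b = 0` that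
define the nonlocal variables `w`. -/
def jointSystem {n m M : ℕ} {κ ι : Type*} (F : Fin M → Jet n (Fin m) → ℝ)
    (G : ι → Jet n (Fin m ⊕ κ) → ℝ) : Fin M ⊕ ι → Jet n (Fin m ⊕ κ) → ℝ :=
  Sum.elim (fun β p => F β (fstJet p)) G

/-- `X` is a symmetry of the system `F_β = 0`: the equations `X(F_β) = 0` hold on the solutions. -/
def IsSymmetry {n m M : ℕ} {κ ι : Type*} (r : WithTop ℕ∞) (F : Fin M → Jet n (Fin m) → ℝ)
    (V : Set (Jet n (Fin m ⊕ κ))) (G : ι → Jet n (Fin m ⊕ κ) → ℝ)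
    (ξ : Fin n → Jet n (Fin m ⊕ κ) → ℝ) (η : Fin m → Jet n (Fin m ⊕ κ) → ℝ) : Prop :=
  ∀ (Ω : Set (Fin n → ℝ)) (s : Fin m ⊕ κ → (Fin n → ℝ) → ℝ),
    IsSolution r V (jointSystem F G) Ω s → ∀ x ∈ Ω, ∀ β, prolong ξ η (F β) (jetOf s x) = 0

/-- The vector with the components
`C^i = ξ^i 𝓛 + W^α δ𝓛/δu^α_i + ∑_{s ≥ 1} D_{j_1} ⋯ D_{j_s}(W^α) δ𝓛/δu^α_{i j_1 ⋯ j_s}`,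
from which `v` is eliminated via `v = φ(x, u)`. -/
noncomputable def conservedVector {n m M : ℕ} {κ : Type*} (F : Fin M → Jet n (Fin m) → ℝ)
    (φ : Fin M → (Fin n → ℝ) × (Fin m → ℝ) → ℝ) (ξ : Fin n → Jet n (Fin m ⊕ κ) → ℝ)
    (η : Fin m → Jet n (Fin m ⊕ κ) → ℝ) (i : Fin n) (p : Jet n (Fin m ⊕ κ)) : ℝ :=
  ξ i p * elimV φ (formalLagrangian F) (fstJet p) +
    ∑ α, ∑ᶠ J : List (Fin n), totalDs J (charW ξ η α) p *
      elimV φ (euler (Sum.inl α) (i :: J) (formalLagrangian F)) (fstJet p)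

/-- `C` is a conserved vector: its components are differential functions on `V`, and the conservation
law `D_i(C^i) = 0` holds on the solutions. -/
def IsConservedVector {n m M : ℕ} {κ ι : Type*} (r : WithTop ℕ∞) (F : Fin M → Jet n (Fin m) → ℝ)
    (V : Set (Jet n (Fin m ⊕ κ))) (G : ι → Jet n (Fin m ⊕ κ) → ℝ)
    (C : Fin n → Jet n (Fin m ⊕ κ) → ℝ) : Prop :=
  (∀ i, IsDiffFun r V (C i)) ∧
  ∀ (Ω : Set (Fin n → ℝ)) (s : Fin m ⊕ κ → (Fin n → ℝ) → ℝ),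
    IsSolution r V (jointSystem F G) Ω s → ∀ x ∈ Ω, ∑ i, totalD i (C i) (jetOf s x) = 0

end Symmetry

end JetCalculus

open JetCalculus

/-! The conservation law is only claimed on solutions, so everything is pulled back to one fixed
solution on an open set `Ω`. Along the jet of a section the chain rule turns `D_i` into the ordinary
`∂_i` (`IsDiffFun.pdBase_comp_jetOf`), and substituting `v = φ(x,u)` amounts to evaluating at the
jet of the enlarged section `(u, φ(x,u))` (`substJet_jetOf`). What remains is a statement about
smooth functions of `x`.

Write `w^α` for the pullback of `W^α`, `P^α_J` for that of the symmetric derivative `∂𝓛/∂u^α_J`, and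
`E^α_J` for that of `δ𝓛/δu^α_J`. Splitting off the first index of the alternating sum gives `E_J =
P_J - ∑_j ∂_j E_{jJ}` (`eulerSum_eq`). With the Leibniz rule, the sum telescopes for each `α` to
`∑_i ∂_i ∑_J ∂_J w E_{iJ} = ∑_I ∂_I w P_I - w E_∅` (`sum_pdBase_sum_eulerSum`).

On a solution `ξ^i 𝓛` vanishes, so the left side summed over `α` is the divergence of `C`. The term
`w E_∅` vanishes by the adjoint equations. Since `𝓛` is linear in `v`, the other term is `∑_β φ^β
∑_{α,I} ∂_I w^α ∂F_β/∂u^α_I`. The inner sum is `X(F_β) - ξ^i D_i(F_β)` (`prolong_eq`): the first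
part vanishes by the symmetry condition, the second because `F_β` is identically zero along the
solution.

Two points need care. Sums run over index sequences while jet coordinates are unordered
multi-indices; the weights are reconciled by counting orderings (`sum_div_countPerms`). The formally
infinite sums are cut at a common order `N` of the `F_β`. -/

namespace JetCalculus

/-! ### Partial derivatives of functions of `x` -/

section Base

variable {n : ℕ} {r : WithTop ℕ∞} {f g : (Fin n → ℝ) → ℝ} {x : Fin n → ℝ} {Ω : Set (Fin n → ℝ)}

/-- Both classes absorb the loss of one derivative, so differentiation stays within class `C^r`. -/
theorem add_one_le_of_smooth (hr : r = ∞ ∨ r = ω) : r + 1 ≤ r := by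
  rcases hr with rfl | rfl <;> simp

theorem ne_zero_of_smooth (hr : r = ∞ ∨ r = ω) : r ≠ 0 := by
  rcases hr with rfl | rfl <;> simp

theorem two_le_of_smooth (hr : r = ∞ ∨ r = ω) : 2 ≤ r := by
  rcases hr with rfl | rfl
  · exact WithTop.coe_le_coe.2 le_top
  · exact le_top

theorem contDiffAt_pdBase (hr : r = ∞ ∨ r = ω) (hf : ContDiffAt ℝ r f x) (i : Fin n) :
    ContDiffAt ℝ r (pdBase i f) x :=
  (hf.fderiv_right (add_one_le_of_smooth hr)).clm_apply contDiffAt_const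

theorem pdBase_congr (h : f =ᶠ[nhds x] g) (i : Fin n) : pdBase i f x = pdBase i g x := by
  simp only [pdBase, h.fderiv_eq]

theorem pdBase_eqOn (hΩ : IsOpen Ω) (h : Set.EqOn f g Ω) (i : Fin n) :
    Set.EqOn (pdBase i f) (pdBase i g) Ω := fun _ hx =>
  pdBase_congr (h.eventuallyEq_of_mem (hΩ.mem_nhds hx)) i

theorem pdBase_comm (hr : r = ∞ ∨ r = ω) (hf : ContDiffAt ℝ r f x) (i j : Fin n) :
    pdBase i (pdBase j f) x = pdBase j (pdBase i f) x := by
  have hs : IsSymmSndFDerivAt ℝ f x :=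
    hf.isSymmSndFDerivAt (by simpa using two_le_of_smooth hr)
  have hd : DifferentiableAt ℝ (fderiv ℝ f) x :=
    (hf.fderiv_right (add_one_le_of_smooth hr)).differentiableAt (ne_zero_of_smooth hr)
  have key : ∀ a b : Fin n, pdBase a (pdBase b f) x
      = fderiv ℝ (fderiv ℝ f) x (Pi.single a 1) (Pi.single b 1) := by
    intro a b
    have : pdBase b f = fun y => fderiv ℝ f y (Pi.single b 1) := rfl
    rw [pdBase, this, fderiv_clm_apply hd (differentiableAt_const _)]
    simp
  rw [key, key]
  exact hs _ _

/-- Iterated partial derivatives of a function of `x`. -/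
noncomputable def pdBases (I : List (Fin n)) (f : (Fin n → ℝ) → ℝ) : (Fin n → ℝ) → ℝ :=
  I.foldr pdBase f

@[simp] theorem pdBases_nil : pdBases [] f = f := rfl

@[simp] theorem pdBases_cons (i : Fin n) (I : List (Fin n)) :
    pdBases (i :: I) f = pdBase i (pdBases I f) := rfl

theorem contDiffAt_pdBases (hr : r = ∞ ∨ r = ω) (hf : ContDiffAt ℝ r f x) (I : List (Fin n)) :
    ContDiffAt ℝ r (pdBases I f) x := by
  induction I with
  | nil => exact hf
  | cons i I ih => exact contDiffAt_pdBase hr ih i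

/-- Adjacent transpositions suffice, and these are the symmetry of second derivatives. Equality on
all of an open set, rather than at a point, is what survives a further differentiation. -/
theorem pdBases_perm (hr : r = ∞ ∨ r = ω) (hΩ : IsOpen Ω) (hf : ∀ x ∈ Ω, ContDiffAt ℝ r f x)
    {I J : List (Fin n)} (h : I.Perm J) : Set.EqOn (pdBases I f) (pdBases J f) Ω := by
  induction h with
  | nil => exact fun _ _ => rfl
  | cons i _ ih => exact pdBase_eqOn hΩ ih i
  | swap i j I => exact fun x hx => pdBase_comm hr (contDiffAt_pdBases hr (hf x hx) I) j i
  | trans _ _ h₁ h₂ => exact h₁.trans h₂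

theorem pdBase_const (i : Fin n) (a : ℝ) : pdBase i (fun _ => a) = fun _ => 0 := by
  funext x
  simp [pdBase]

theorem pdBase_mul (hf : DifferentiableAt ℝ f x) (hg : DifferentiableAt ℝ g x) (i : Fin n) :
    pdBase i (fun y => f y * g y) x = pdBase i f x * g x + f x * pdBase i g x := by
  simp only [pdBase]
  rw [fderiv_fun_mul hf hg]
  simp
  ring

theorem pdBase_const_mul (hf : DifferentiableAt ℝ f x) (a : ℝ) (i : Fin n) :
    pdBase i (fun y => a * f y) x = a * pdBase i f x := by
  simp only [pdBase]
  rw [fderiv_const_mul hf]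
  simp

theorem pdBase_sum {ι : Type*} {s : Finset ι} {A : ι → (Fin n → ℝ) → ℝ}
    (h : ∀ k ∈ s, DifferentiableAt ℝ (A k) x) (i : Fin n) :
    pdBase i (fun y => ∑ k ∈ s, A k y) x = ∑ k ∈ s, pdBase i (A k) x := by
  simp only [pdBase]
  rw [fderiv_fun_sum h]
  simp

end Base

/-! ### Index sequences and orderings of multi-indices -/

section Lists

variable {n : ℕ}

/-- The sequences of indices of length at most `N`. -/
noncomputable def listsUpTo (n : ℕ) : ℕ → Finset (List (Fin n))
  | 0 => {[]}
  | N + 1 => insert [] ((Finset.univ ×ˢ listsUpTo n N).image fun c => c.1 :: c.2)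

theorem mem_listsUpTo {N : ℕ} {I : List (Fin n)} : I ∈ listsUpTo n N ↔ I.length ≤ N := by
  induction N generalizing I with
  | zero => simp [listsUpTo]
  | succ N ih => cases I <;> simp [listsUpTo, ih]

theorem sum_listsUpTo_succ {R : Type*} [AddCommMonoid R] (N : ℕ) (f : List (Fin n) → R) :
    ∑ I ∈ listsUpTo n (N + 1), f I = f [] + ∑ i, ∑ J ∈ listsUpTo n N, f (i :: J) := by
  classical
  rw [listsUpTo, Finset.sum_insert (by simp), Finset.sum_image, Finset.sum_product]
  rintro ⟨a, b⟩ _ ⟨c, d⟩ _ h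
  simpa using h

theorem finsum_list_eq_sum {R : Type*} [AddCommMonoid R] {N : ℕ} {f : List (Fin n) → R}
    (h : ∀ I, N < I.length → f I = 0) : ∑ᶠ I, f I = ∑ I ∈ listsUpTo n N, f I := by
  refine finsum_eq_sum_of_support_subset _ fun I hI => ?_
  rw [Finset.mem_coe, mem_listsUpTo]
  by_contra hlt
  exact hI (h I (not_le.1 hlt))

/-- Splitting by the first index naturally lowers the bound by one. Here the extra terms `i :: J` of
length `N + 1` are zero, so the same cutoff `N` serves both sides, as the telescoping requires. -/
theorem sum_listsUpTo_eq {R : Type*} [AddCommMonoid R] {N : ℕ} {f : List (Fin n) → R}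
    (h : ∀ I, N < I.length → f I = 0) :
    ∑ I ∈ listsUpTo n N, f I = f [] + ∑ i, ∑ J ∈ listsUpTo n N, f (i :: J) := by
  rw [← finsum_list_eq_sum h, finsum_list_eq_sum (N := N + 1) fun I hI => h I (by omega),
    sum_listsUpTo_succ]

/-- Induction on the first letter: orderings of `J` starting with `i` are orderings of `J.erase i`,
and after clearing denominators they contribute `J.count i * (|J| - 1)!`. The counts add up to
`|J|`. -/
theorem card_orderings_mul_prod_factorial {N : ℕ} {J : Multiset (Fin n)} (hJ : J.card ≤ N) :
    (∑ I ∈ listsUpTo n N, if (I : Multiset (Fin n)) = J then 1 else 0)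
      * ∏ i, (J.count i).factorial = J.card.factorial := by
  induction N generalizing J with
  | zero =>
    obtain rfl : J = 0 := by simpa using hJ
    simp [listsUpTo]
  | succ N ih =>
    rw [sum_listsUpTo_succ]
    rcases eq_or_ne J 0 with rfl | h0
    · simp [← Multiset.cons_coe]
    · have hnil : ((([] : List (Fin n)) : Multiset (Fin n)) = J) ↔ False := by
        simpa using h0.symm
      obtain ⟨k, hk⟩ : ∃ k, J.card = k + 1 :=
        Nat.exists_eq_succ_of_ne_zero (by simpa using h0)
      have hterm : ∀ i, (∑ I ∈ listsUpTo n N,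
          if ((i :: I : List (Fin n)) : Multiset (Fin n)) = J then 1 else 0)
            * ∏ i, (J.count i).factorial = J.count i * k.factorial := by
        intro i
        by_cases hi : i ∈ J
        · have hc : (J.erase i).card = k := by rw [Multiset.card_erase_of_mem hi, hk]; rfl
          have := ih (J := J.erase i) (by omega)
          have hsum : (∑ I ∈ listsUpTo n N,
              if ((i :: I : List (Fin n)) : Multiset (Fin n)) = J then 1 else 0)
              = ∑ I ∈ listsUpTo n N, if (I : Multiset (Fin n)) = J.erase i then 1 else 0 := by
            refine Finset.sum_congr rfl fun I _ => ?_
            congr 1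
            rw [← Multiset.cons_coe, eq_iff_iff]
            constructor
            · rintro rfl; simp
            · intro h; rw [h, Multiset.cons_erase hi]
          have hprod : ∏ j, (J.count j).factorial
              = J.count i * ∏ j, ((J.erase i).count j).factorial := by
            rw [← Finset.mul_prod_erase _ _ (Finset.mem_univ i),
              ← Finset.mul_prod_erase (f := fun j => ((J.erase i).count j).factorial) _
                (Finset.mem_univ i), ← mul_assoc, Multiset.count_erase_self,
              Nat.mul_factorial_pred (Multiset.count_pos.2 hi).ne']
            congr 1
            refine Finset.prod_congr rfl fun j hj => ?_
            rw [Multiset.count_erase_of_ne (Finset.ne_of_mem_erase hj)]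
          rw [hsum, hprod, mul_left_comm, this, hc]
        · rw [Multiset.count_eq_zero.2 hi, zero_mul, mul_eq_zero]
          left
          refine Finset.sum_eq_zero fun I _ => if_neg ?_
          rintro rfl
          exact hi (by simp)
      rw [if_neg (by simpa using hnil), zero_add, Finset.sum_mul, Finset.sum_congr rfl fun i _ => hterm i,
        ← Finset.sum_mul, Multiset.sum_count_eq_card (fun _ _ => Finset.mem_univ _), hk,
        Nat.factorial_succ]

/-- The number of orderings of a multi-index is the multinomial coefficient. -/
theorem card_orderings {N : ℕ} {J : Multiset (Fin n)} (hJ : J.card ≤ N) :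
    (∑ I ∈ listsUpTo n N, if (I : Multiset (Fin n)) = J then 1 else 0) = J.countPerms := by
  have hp : 0 < ∏ i, (J.count i).factorial := Finset.prod_pos fun i _ => Nat.factorial_pos _
  refine Nat.eq_of_mul_eq_mul_right hp ?_
  rw [card_orderings_mul_prod_factorial hJ, Multiset.countPerms,
    Finsupp.multinomial_eq_of_support_subset (Finset.subset_univ _), mul_comm]
  have h := Nat.multinomial_spec Finset.univ J.toFinsupp
  simp only [Multiset.toFinsupp_apply] at h
  rw [h, Multiset.sum_count_eq_card fun _ _ => Finset.mem_univ _]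

theorem countPerms_pos (J : Multiset (Fin n)) : 0 < J.countPerms := by
  rw [← card_orderings le_rfl]
  exact Finset.sum_pos' (fun _ _ => Nat.zero_le _)
    ⟨J.toList, by simp [mem_listsUpTo], by simp⟩

/-- Each multi-index of size at most `N` is reached by exactly `countPerms` sequences, which cancels
the weight of the symmetric form. -/
theorem sum_div_countPerms {N : ℕ} {h : Multiset (Fin n) → ℝ}
    (hN : ∀ J, N < J.card → h J = 0) :
    ∑ I ∈ listsUpTo n N, h I / ((I : Multiset (Fin n)).countPerms : ℝ) = ∑ᶠ J, h J := by
  rw [Finset.sum_comp (fun J : Multiset (Fin n) => h J / (J.countPerms : ℝ))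
    (fun I : List (Fin n) => (I : Multiset (Fin n)))]
  rw [finsum_eq_sum_of_support_subset
    (s := (listsUpTo n N).image fun I : List (Fin n) => (I : Multiset (Fin n)))]
  · refine Finset.sum_congr rfl fun J hJ => ?_
    obtain ⟨I, hI, rfl⟩ := Finset.mem_image.1 hJ
    have hc := card_orderings (N := N) (J := (I : Multiset (Fin n)))
      (by simpa using mem_listsUpTo.1 hI)
    rw [Finset.card_filter, hc, nsmul_eq_mul, mul_div_cancel₀]
    exact_mod_cast (countPerms_pos _).ne'
  · intro J hJ
    rw [Finset.mem_coe, Finset.mem_image]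
    refine ⟨J.toList, ?_, by simp⟩
    rw [mem_listsUpTo, Multiset.length_toList]
    by_contra hlt
    exact hJ (hN J (not_le.1 hlt))

end Lists

/-! ### Integration by parts for functions of `x` -/

section Noether

variable {n N : ℕ} {r : WithTop ℕ∞} {Ω : Set (Fin n → ℝ)}
  {P : Multiset (Fin n) → (Fin n → ℝ) → ℝ} {w : (Fin n → ℝ) → ℝ}

/-- The alternating sum `∑ (-1)^t ∂_{j_1} ⋯ ∂_{j_t} P_{J j_1 ⋯ j_t}` over sequences of length at
most `N`. -/
noncomputable def eulerSum (N : ℕ) (P : Multiset (Fin n) → (Fin n → ℝ) → ℝ)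
    (J : Multiset (Fin n)) (x : Fin n → ℝ) : ℝ :=
  ∑ K ∈ listsUpTo n N, (-1 : ℝ) ^ K.length * pdBases K (P (J + (K : Multiset (Fin n)))) x

theorem contDiffAt_eulerSum (hr : r = ∞ ∨ r = ω) {x : Fin n → ℝ}
    (hP : ∀ J, ContDiffAt ℝ r (P J) x) (J : Multiset (Fin n)) :
    ContDiffAt ℝ r (eulerSum N P J) x :=
  ContDiffAt.sum fun _ _ => contDiffAt_const.mul (contDiffAt_pdBases hr (hP _) _)

theorem pdBases_zero_of_eqOn (hΩ : IsOpen Ω) {f : (Fin n → ℝ) → ℝ} (hf : ∀ x ∈ Ω, f x = 0)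
    (K : List (Fin n)) : ∀ x ∈ Ω, pdBases K f x = 0 := by
  induction K with
  | nil => exact hf
  | cons i K ih =>
    intro x hx
    have := pdBase_eqOn hΩ (g := fun _ => 0) ih i hx
    rwa [pdBase_const] at this

theorem eulerSum_eq_zero (hΩ : IsOpen Ω) (hPN : ∀ J, N < J.card → ∀ x ∈ Ω, P J x = 0)
    {J : Multiset (Fin n)} (hJ : N < J.card) : ∀ x ∈ Ω, eulerSum N P J x = 0 := by
  intro x hx
  refine Finset.sum_eq_zero fun K _ => ?_
  rw [pdBases_zero_of_eqOn hΩ (hPN _ (by rw [Multiset.card_add]; omega)) K x hx, mul_zero]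

/-- The empty sequence contributes `P J`. The sequences with first index `j` have one more
derivative `∂_j` and one more sign than the terms of `eulerSum N P (j ::ₘ J)`, so together they give
its `-∂_j`. -/
theorem eulerSum_eq (hr : r = ∞ ∨ r = ω) (hΩ : IsOpen Ω)
    (hP : ∀ J, ∀ x ∈ Ω, ContDiffAt ℝ r (P J) x)
    (hPN : ∀ J, N < J.card → ∀ x ∈ Ω, P J x = 0) (J : Multiset (Fin n)) :
    ∀ x ∈ Ω, eulerSum N P J x = P J x - ∑ j, pdBase j (eulerSum N P (j ::ₘ J)) x := by
  intro x hx
  have hrec : ∀ j, pdBase j (eulerSum N P (j ::ₘ J)) x = ∑ K ∈ listsUpTo n N,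
      (-1 : ℝ) ^ K.length * pdBases (j :: K) (P (J + ((j :: K : List (Fin n)) : Multiset (Fin n)))) x := by
    intro j
    have hd : ∀ K, DifferentiableAt ℝ (pdBases K (P (j ::ₘ J + (K : Multiset (Fin n))))) x :=
      fun K => (contDiffAt_pdBases hr (hP _ x hx) K).differentiableAt (ne_zero_of_smooth hr)
    have hE : eulerSum N P (j ::ₘ J) = fun y => ∑ K ∈ listsUpTo n N,
        (-1 : ℝ) ^ K.length * pdBases K (P (j ::ₘ J + (K : Multiset (Fin n)))) y := rfl
    rw [hE, pdBase_sum fun K _ => (hd K).const_mul _]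
    refine Finset.sum_congr rfl fun K _ => ?_
    rw [pdBase_const_mul (hd K), pdBases_cons, ← Multiset.cons_coe, Multiset.add_cons,
      Multiset.cons_add]
  rw [eulerSum, sum_listsUpTo_eq fun K hK => ?_]
  · simp only [hrec, List.length_nil, pow_zero, one_mul, pdBases_nil, Multiset.coe_nil, add_zero,
      List.length_cons, pow_succ, mul_neg, mul_one, neg_mul, Finset.sum_neg_distrib, sub_eq_add_neg]
  · rw [pdBases_zero_of_eqOn hΩ (hPN _ _) K x hx, mul_zero]
    rw [Multiset.card_add, Multiset.coe_card]
    omega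

/-- Integration by parts: `∑ ∂_I w P_I - w E_∅` is the divergence of `∑ ∂_J w E_{iJ}`. -/
theorem sum_pdBase_sum_eulerSum (hr : r = ∞ ∨ r = ω) (hΩ : IsOpen Ω)
    (hw : ∀ x ∈ Ω, ContDiffAt ℝ r w x) (hP : ∀ J, ∀ x ∈ Ω, ContDiffAt ℝ r (P J) x)
    (hPN : ∀ J, N < J.card → ∀ x ∈ Ω, P J x = 0) : ∀ x ∈ Ω,
    ∑ i, pdBase i (fun y => ∑ J ∈ listsUpTo n N,
        pdBases J w y * eulerSum N P (i ::ₘ (J : Multiset (Fin n))) y) x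
      = ∑ I ∈ listsUpTo n N, pdBases I w x * P I x - w x * eulerSum N P 0 x := by
  intro x hx
  have hdw : ∀ J, DifferentiableAt ℝ (pdBases J w) x :=
    fun J => (contDiffAt_pdBases hr (hw x hx) J).differentiableAt (ne_zero_of_smooth hr)
  have hdE : ∀ J, DifferentiableAt ℝ (eulerSum N P J) x :=
    fun J => (contDiffAt_eulerSum hr (fun J => hP J x hx) J).differentiableAt
      (ne_zero_of_smooth hr)
  have h1 : ∀ i, pdBase i (fun y => ∑ J ∈ listsUpTo n N,
        pdBases J w y * eulerSum N P (i ::ₘ (J : Multiset (Fin n))) y) x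
      = ∑ J ∈ listsUpTo n N, pdBases (i :: J) w x
          * eulerSum N P ((i :: J : List (Fin n)) : Multiset (Fin n)) x
        + ∑ J ∈ listsUpTo n N, pdBases J w x
          * pdBase i (eulerSum N P (i ::ₘ (J : Multiset (Fin n)))) x := by
    intro i
    rw [pdBase_sum fun J _ => (hdw J).fun_mul (hdE _), ← Finset.sum_add_distrib]
    exact Finset.sum_congr rfl fun J _ => pdBase_mul (hdw J) (hdE _) i
  -- In `∑_I ∂_I w E_I`, the nonempty sequences reproduce the first half of the Leibniz rule in
  -- `h1`; the empty one leaves `w E_∅`.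
  have h2 := sum_listsUpTo_eq (N := N)
    (f := fun I => pdBases I w x * eulerSum N P (I : Multiset (Fin n)) x) fun I hI => by
      rw [eulerSum_eq_zero hΩ hPN (by simpa using hI) x hx, mul_zero]
  -- The recursion in the form `P_I = E_I + ∑_i ∂_i E_{iI}`; its second part is the other half of
  -- the Leibniz rule.
  have h3 : ∑ I ∈ listsUpTo n N, pdBases I w x * P I x
      = ∑ I ∈ listsUpTo n N, pdBases I w x * eulerSum N P (I : Multiset (Fin n)) x
        + ∑ i, ∑ J ∈ listsUpTo n N, pdBases J w x
          * pdBase i (eulerSum N P (i ::ₘ (J : Multiset (Fin n)))) x := by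
    rw [Finset.sum_comm, ← Finset.sum_add_distrib]
    refine Finset.sum_congr rfl fun I _ => ?_
    rw [eulerSum_eq hr hΩ hP hPN _ x hx, ← Finset.mul_sum]
    ring
  simp only [h1, Finset.sum_add_distrib]
  rw [h3, h2]
  simp only [pdBases_nil, Multiset.coe_nil]
  ring

end Noether

/-! ### Differential functions: closure properties and finite order -/

section DiffFun

variable {n : ℕ} {D : Type*} {r : WithTop ℕ∞} {U : Set (Jet n D)} {f g : Jet n D → ℝ}

/-- All the functions are read as functions of the union of their finite coordinate sets. The
algebraic closure properties below are instances. -/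
theorem IsDiffFun.comp_finite {ι : Type*} [Fintype ι] (hU : IsOpen U) {f : ι → Jet n D → ℝ}
    (hf : ∀ k, IsDiffFun r U (f k)) {h : (ι → ℝ) → ℝ}
    (hh : ∀ p ∈ U, ContDiffAt ℝ r h fun k => f k p) :
    IsDiffFun r U fun p => h fun k => f k p := by
  classical
  choose S g hg using fun k => (hf k).2
  have hsub : ∀ k, S k ⊆ Finset.univ.biUnion S :=
    fun k => Finset.subset_biUnion_of_mem S (Finset.mem_univ k)
  have hval : ∀ p ∈ U, (fun k => f k p) = fun k => g k ((S k).restrict p) :=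
    fun p hp => funext fun k => (hg k p hp).1
  refine ⟨hU, Finset.univ.biUnion S, fun y => h fun k => g k fun c => y ⟨c, hsub k c.2⟩,
    fun p hp => ⟨congrArg h (hval p hp), ?_⟩⟩
  have hh' := hh p hp
  rw [hval p hp] at hh'
  refine ContDiffAt.comp _ (f := fun (y : (Finset.univ.biUnion S) → ℝ) k =>
    g k fun c => y ⟨c, hsub k c.2⟩) hh' ?_
  refine contDiffAt_pi.2 fun k => ContDiffAt.comp _ (hg k p hp).2 ?_
  exact contDiffAt_pi.2 fun c => contDiffAt_apply _ _ _ _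

theorem isDiffFun_coord (hU : IsOpen U) (c : JetCoord n D) : IsDiffFun r U fun p => p c :=
  ⟨hU, {c}, fun y => y ⟨c, Finset.mem_singleton_self c⟩,
    fun _ _ => ⟨rfl, contDiffAt_apply _ _ _ _⟩⟩

theorem isDiffFun_const (hU : IsOpen U) (a : ℝ) : IsDiffFun r U fun _ => a :=
  ⟨hU, ∅, fun _ => a, fun _ _ => ⟨rfl, contDiffAt_const⟩⟩

theorem IsDiffFun.congr (hf : IsDiffFun r U f) (h : Set.EqOn g f U) : IsDiffFun r U g := by
  obtain ⟨hU, S, k, hk⟩ := hf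
  exact ⟨hU, S, k, fun p hp => ⟨(h hp).trans (hk p hp).1, (hk p hp).2⟩⟩

theorem IsDiffFun.sum {ι : Type*} (hU : IsOpen U) {s : Finset ι} {f : ι → Jet n D → ℝ}
    (hf : ∀ k ∈ s, IsDiffFun r U (f k)) : IsDiffFun r U fun p => ∑ k ∈ s, f k p := by
  have := IsDiffFun.comp_finite hU (f := fun (k : s) => f k) (fun k => hf k k.2)
    (h := fun y => ∑ k, y k) fun p _ => ContDiffAt.sum fun k _ => contDiffAt_apply _ _ _ _
  refine this.congr fun p _ => ?_
  exact (Finset.sum_coe_sort s fun k => f k p).symm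

theorem IsDiffFun.mul (hf : IsDiffFun r U f) (hg : IsDiffFun r U g) :
    IsDiffFun r U fun p => f p * g p := by
  have := IsDiffFun.comp_finite hf.1 (f := fun b : Bool => cond b f g)
    (fun b => by cases b <;> assumption) (h := fun y => y true * y false)
    fun p _ => (contDiffAt_apply _ _ _ _).mul (contDiffAt_apply _ _ _ _)
  exact this

theorem IsDiffFun.add (hf : IsDiffFun r U f) (hg : IsDiffFun r U g) :
    IsDiffFun r U fun p => f p + g p := by
  have := IsDiffFun.comp_finite hf.1 (f := fun b : Bool => cond b f g)
    (fun b => by cases b <;> assumption) (h := fun y => y true + y false)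
    fun p _ => (contDiffAt_apply _ _ _ _).add (contDiffAt_apply _ _ _ _)
  exact this

theorem IsDiffFun.sub (hf : IsDiffFun r U f) (hg : IsDiffFun r U g) :
    IsDiffFun r U fun p => f p - g p := by
  have := IsDiffFun.comp_finite hf.1 (f := fun b : Bool => cond b f g)
    (fun b => by cases b <;> assumption) (h := fun y => y true - y false)
    fun p _ => (contDiffAt_apply _ _ _ _).sub (contDiffAt_apply _ _ _ _)
  exact this

theorem IsDiffFun.comp {D' : Type*} {n' : ℕ} {U' : Set (Jet n' D')} {f : Jet n' D' → ℝ}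
    (hf : IsDiffFun r U' f) (hU : IsOpen U) {Φ : Jet n D → Jet n' D'}
    (hΦ : ∀ c, IsDiffFun r U fun p => Φ p c) (hm : ∀ p ∈ U, Φ p ∈ U') :
    IsDiffFun r U fun p => f (Φ p) := by
  obtain ⟨-, S, g, hg⟩ := hf
  have := IsDiffFun.comp_finite hU (f := fun (c : S) p => Φ p c) (fun c => hΦ c) (h := g)
    fun p hp => (hg _ (hm p hp)).2
  exact this.congr fun p hp => (hg _ (hm p hp)).1

section Representation

variable {S : Finset (JetCoord n D)} {k : (S → ℝ) → ℝ} {p : Jet n D}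

-- The representation `f = k ∘ S.restrict` holds only on `U`. Openness of `U` in the product
-- topology keeps small changes of one coordinate inside it, so the derivative can be computed from
-- `k`.
open Classical in
theorem hasDerivAt_update_of_rep (hU : IsOpen U) (hk : ∀ p ∈ U, f p = k (S.restrict p))
    (hp : p ∈ U) (hd : DifferentiableAt ℝ k (S.restrict p)) (c : JetCoord n D) :
    HasDerivAt (fun t : ℝ => f (Function.update p c t))
      (fderiv ℝ k (S.restrict p) (S.restrict (Pi.single c (1 : ℝ) : Jet n D))) (p c) := by
  have hcont : Continuous fun t : ℝ => Function.update p c t :=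
    continuous_const.update c continuous_id
  have hev : (fun t : ℝ => f (Function.update p c t))
      =ᶠ[nhds (p c)] fun t => k (S.restrict (Function.update p c t)) := by
    have : ∀ᶠ t in nhds (p c), Function.update p c t ∈ U :=
      hcont.continuousAt.eventually_mem (by simpa using hU.mem_nhds hp)
    filter_upwards [this] with t ht using hk _ ht
  refine HasDerivAt.congr_of_eventuallyEq ?_ hev
  have hinner : HasDerivAt (fun t : ℝ => S.restrict (Function.update p c t))
      (S.restrict (Pi.single c (1 : ℝ) : Jet n D)) (p c) := by
    rw [hasDerivAt_pi]
    rintro ⟨e, he⟩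
    by_cases h : e = c
    · subst h
      simpa using hasDerivAt_id' (p e)
    · simpa [h] using hasDerivAt_const (p c) (p e)
  have := HasFDerivAt.comp_hasDerivAt (p c) (l := k)
    (f := fun t : ℝ => S.restrict (Function.update p c t)) (by simpa using hd.hasFDerivAt) hinner
  simpa [Function.comp_def] using this

open Classical in
theorem pdJet_of_rep (hU : IsOpen U) (hk : ∀ p ∈ U, f p = k (S.restrict p))
    (hp : p ∈ U) (hd : DifferentiableAt ℝ k (S.restrict p)) (c : JetCoord n D) :
    pdJet c f p = fderiv ℝ k (S.restrict p) (S.restrict (Pi.single c (1 : ℝ) : Jet n D)) :=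
  (hasDerivAt_update_of_rep hU hk hp hd c).deriv

theorem pdJet_eq_zero_of_rep (hU : IsOpen U) (hk : ∀ p ∈ U, f p = k (S.restrict p))
    (hp : p ∈ U) (hd : DifferentiableAt ℝ k (S.restrict p)) {c : JetCoord n D} (hc : c ∉ S) :
    pdJet c f p = 0 := by
  classical
  rw [pdJet_of_rep hU hk hp hd]
  have hz : S.restrict (Pi.single c (1 : ℝ) : Jet n D) = 0 := by
    ext ⟨e, he⟩
    have : e ≠ c := by rintro rfl; exact hc he
    simp [this]
  rw [hz, map_zero]

/-- The coordinates of the total differentiation `D_i` as a vector field on the jet space. -/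
def totalStep (i : Fin n) (p : Jet n D) : Jet n D
  | Sum.inl j => if j = i then 1 else 0
  | Sum.inr (d, J) => p (cu d (i ::ₘ J))

theorem totalD_eq_sum (hU : IsOpen U) (hk : ∀ p ∈ U, f p = k (S.restrict p))
    (hp : p ∈ U) (hd : DifferentiableAt ℝ k (S.restrict p)) (i : Fin n) :
    totalD i f p = ∑ c ∈ S, totalStep i p c * pdJet c f p := by
  classical
  have hz : ∀ c, c ∉ S → pdJet c f p = 0 := fun c hc => pdJet_eq_zero_of_rep hU hk hp hd hc
  -- `S` is enlarged by all the variables `x^j`, so that the `x`-part becomes a full sum in which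
  -- `totalStep i` selects `j = i`, even when `x^i` is not in `S`.
  have hsub : S ⊆ Finset.disjSum Finset.univ S.toRight := by
    rintro (j | c) hc <;> simp [hc]
  rw [Finset.sum_subset hsub fun c _ hc => by rw [hz c hc, mul_zero], Finset.sum_disjSum, totalD,
    finsum_eq_sum_of_support_subset (s := S.toRight)]
  · simp [totalStep]
  · intro c hc
    rw [Finset.mem_coe, Finset.mem_toRight]
    by_contra h
    exact hc (by simp only [hz _ h, mul_zero])

/-- This form of `D_i`, a directional derivative of a function of finitely many variables, is the
one to which the chain rule along a section applies. -/
theorem totalD_of_rep (hU : IsOpen U) (hk : ∀ p ∈ U, f p = k (S.restrict p))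
    (hp : p ∈ U) (hd : DifferentiableAt ℝ k (S.restrict p)) (i : Fin n) :
    totalD i f p = fderiv ℝ k (S.restrict p) (S.restrict (totalStep i p)) := by
  classical
  rw [totalD_eq_sum hU hk hp hd]
  have : S.restrict (totalStep i p)
      = ∑ c ∈ S, totalStep i p c • S.restrict (Pi.single c (1 : ℝ) : Jet n D) := by
    ext ⟨e, he⟩
    simp [Pi.single_apply, he]
  rw [this, map_sum]
  refine Finset.sum_congr rfl fun c _ => ?_
  rw [map_smul, pdJet_of_rep hU hk hp hd, smul_eq_mul]

end Representation

theorem pdJet_eqOn (hU : IsOpen U) (h : Set.EqOn f g U) (c : JetCoord n D) :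
    Set.EqOn (pdJet c f) (pdJet c g) U := by
  classical
  intro p hp
  have hcont : Continuous fun t : ℝ => Function.update p c t :=
    continuous_const.update c continuous_id
  have hm : ∀ᶠ t in nhds (p c), Function.update p c t ∈ U :=
    hcont.continuousAt.eventually_mem (by simpa using hU.mem_nhds hp)
  refine Filter.EventuallyEq.deriv_eq ?_
  filter_upwards [hm] with t ht
  convert h ht

theorem totalD_eqOn (hU : IsOpen U) (h : Set.EqOn f g U) (i : Fin n) :
    Set.EqOn (totalD i f) (totalD i g) U := by
  intro p hp
  simp only [totalD, pdJet_eqOn hU h _ hp]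

theorem totalDs_eqOn (hU : IsOpen U) (h : Set.EqOn f g U) (I : List (Fin n)) :
    Set.EqOn (totalDs I f) (totalDs I g) U := by
  induction I with
  | nil => exact h
  | cons i I ih => exact totalD_eqOn hU ih i

@[simp] theorem totalDs_cons (i : Fin n) (I : List (Fin n)) :
    totalDs (i :: I) f = totalD i (totalDs I f) := rfl

theorem totalDs_zero (hU : IsOpen U) (h : ∀ p ∈ U, f p = 0) (I : List (Fin n)) :
    ∀ p ∈ U, totalDs I f p = 0 := by
  intro p hp
  have hz : ∀ I : List (Fin n), totalDs I (fun _ : Jet n D => (0 : ℝ)) = fun _ => 0 := by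
    intro I
    induction I with
    | nil => rfl
    | cons i I ih =>
      rw [totalDs_cons, ih]
      funext q
      simp [totalD, pdJet]
  rw [totalDs_eqOn hU (g := fun _ => 0) h I hp, hz]

/-- Frees `pdJet` from the classical decidability instance fixed in its definition. -/
theorem pdJet_eq_deriv [h : DecidableEq (JetCoord n D)] (c : JetCoord n D) (f : Jet n D → ℝ)
    (p : Jet n D) : pdJet c f p = deriv (fun t : ℝ => f (Function.update p c t)) (p c) := by
  rw [pdJet]
  congr!

theorem IsDiffFun.hasDerivAt_update [DecidableEq (JetCoord n D)] (hr : r = ∞ ∨ r = ω)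
    (hf : IsDiffFun r U f) {p : Jet n D} (hp : p ∈ U) (c : JetCoord n D) :
    HasDerivAt (fun t : ℝ => f (Function.update p c t)) (pdJet c f p) (p c) := by
  obtain ⟨hU, S, k, hk⟩ := hf
  have hd := (hk p hp).2.differentiableAt (ne_zero_of_smooth hr)
  have := hasDerivAt_update_of_rep hU (fun p hp => (hk p hp).1) hp hd c
  rw [← pdJet_of_rep hU (fun p hp => (hk p hp).1) hp hd] at this
  convert! this

theorem IsDiffFun.pdJet (hr : r = ∞ ∨ r = ω) (hf : IsDiffFun r U f) (c : JetCoord n D) :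
    IsDiffFun r U (pdJet c f) := by
  classical
  obtain ⟨hU, S, k, hk⟩ := hf
  refine ⟨hU, S, fun y => fderiv ℝ k y (S.restrict (Pi.single c (1 : ℝ) : Jet n D)),
    fun p hp => ⟨?_, ?_⟩⟩
  · rw [pdJet_of_rep hU (fun p hp => (hk p hp).1) hp
      ((hk p hp).2.differentiableAt (ne_zero_of_smooth hr))]
  · exact ((hk p hp).2.fderiv_right (add_one_le_of_smooth hr)).clm_apply contDiffAt_const

theorem IsDiffFun.totalD (hr : r = ∞ ∨ r = ω) (hf : IsDiffFun r U f) (i : Fin n) :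
    IsDiffFun r U (totalD i f) := by
  have hf' := hf
  obtain ⟨hU, S, k, hk⟩ := hf'
  have : IsDiffFun r U fun p => ∑ c ∈ S, totalStep i p c * JetCalculus.pdJet c f p := by
    refine IsDiffFun.sum hU fun c _ => IsDiffFun.mul ?_ (hf.pdJet hr c)
    rcases c with j | ⟨d, J⟩
    · exact isDiffFun_const hU _
    · exact isDiffFun_coord hU _
  exact this.congr fun p hp => totalD_eq_sum hU (fun p hp => (hk p hp).1) hp
    ((hk p hp).2.differentiableAt (ne_zero_of_smooth hr)) i

theorem IsDiffFun.totalDs (hr : r = ∞ ∨ r = ω) (hf : IsDiffFun r U f) (I : List (Fin n)) :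
    IsDiffFun r U (totalDs I f) := by
  induction I with
  | nil => exact hf
  | cons i I ih => exact ih.totalD hr i

theorem IsDiffFun.symPd (hr : r = ∞ ∨ r = ω) (hf : IsDiffFun r U f) (d : D) (I : List (Fin n)) :
    IsDiffFun r U (symPd d I f) :=
  (hf.pdJet hr _).mul (isDiffFun_const hf.1 _)

/-- A differential function has a finite order. -/
theorem IsDiffFun.exists_order (hr : r = ∞ ∨ r = ω) (hf : IsDiffFun r U f) :
    ∃ N : ℕ, ∀ d J, N < Multiset.card J → ∀ p ∈ U, JetCalculus.pdJet (cu d J) f p = 0 := by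
  obtain ⟨hU, S, k, hk⟩ := hf
  refine ⟨S.toRight.sup fun c => c.2.card, fun d J hJ p hp => ?_⟩
  refine pdJet_eq_zero_of_rep hU (fun p hp => (hk p hp).1) hp
    ((hk p hp).2.differentiableAt (ne_zero_of_smooth hr)) fun hc => ?_
  have : J.card ≤ _ := Finset.le_sup (f := fun c : D × Multiset (Fin n) => c.2.card)
    (Finset.mem_toRight.2 hc)
  omega

theorem IsDiffFun.finite_support_pdJet (hr : r = ∞ ∨ r = ω) (hf : IsDiffFun r U f) {p : Jet n D}
    (hp : p ∈ U) : (Function.support fun c : D × Multiset (Fin n) =>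
      JetCalculus.pdJet (cu c.1 c.2) f p).Finite := by
  obtain ⟨hU, S, k, hk⟩ := hf
  refine S.toRight.finite_toSet.subset fun c hc => ?_
  rw [Finset.mem_coe, Finset.mem_toRight]
  by_contra h
  exact hc (pdJet_eq_zero_of_rep hU (fun p hp => (hk p hp).1) hp
    ((hk p hp).2.differentiableAt (ne_zero_of_smooth hr)) h)

/-! ### Euler operators as finite sums -/

section Euler

variable {N : ℕ} {d : D}

theorem euler_eq_sum (hU : IsOpen U)
    (hN : ∀ J, N < Multiset.card J → ∀ p ∈ U, pdJet (cu d J) f p = 0) (I : List (Fin n))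
    {p : Jet n D} (hp : p ∈ U) :
    euler d I f p
      = ∑ K ∈ listsUpTo n N, (-1 : ℝ) ^ K.length * totalDs K (symPd d (I ++ K) f) p := by
  refine finsum_list_eq_sum fun K hK => ?_
  rw [totalDs_zero hU _ K p hp, mul_zero]
  intro q hq
  rw [symPd, hN _ _ q hq, zero_div]
  rw [Multiset.coe_card, List.length_append]
  omega

theorem euler_eq_zero (hU : IsOpen U)
    (hN : ∀ J, N < Multiset.card J → ∀ p ∈ U, pdJet (cu d J) f p = 0) {I : List (Fin n)}
    (hI : N < I.length) {p : Jet n D} (hp : p ∈ U) : euler d I f p = 0 := by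
  rw [euler_eq_sum hU hN I hp]
  refine Finset.sum_eq_zero fun K _ => ?_
  rw [totalDs_zero hU _ K p hp, mul_zero]
  intro q hq
  rw [symPd, hN _ _ q hq, zero_div]
  rw [Multiset.coe_card, List.length_append]
  omega

theorem IsDiffFun.euler (hr : r = ∞ ∨ r = ω) (hf : IsDiffFun r U f)
    (hN : ∀ J, N < Multiset.card J → ∀ p ∈ U, JetCalculus.pdJet (cu d J) f p = 0)
    (I : List (Fin n)) : IsDiffFun r U (euler d I f) := by
  refine IsDiffFun.congr (IsDiffFun.sum hf.1 fun K _ => ?_) fun p hp => euler_eq_sum hf.1 hN I hp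
  exact (isDiffFun_const hf.1 _).mul ((hf.symPd hr d _).totalDs hr K)

end Euler

end DiffFun

/-! ### Pullback along the jet of a section -/

section Sections

variable {n : ℕ} {D : Type*} {r : WithTop ℕ∞} {U : Set (Jet n D)} {f : Jet n D → ℝ}
  {Ω : Set (Fin n → ℝ)} {s : D → (Fin n → ℝ) → ℝ}

theorem contDiffAt_jetOf (hr : r = ∞ ∨ r = ω) {x : Fin n → ℝ}
    (hs : ∀ d, ContDiffAt ℝ r (s d) x) (c : JetCoord n D) :
    ContDiffAt ℝ r (fun y => jetOf s y c) x := by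
  rcases c with i | ⟨d, J⟩
  · exact contDiffAt_apply _ _ _ _
  · exact contDiffAt_pdBases hr (hs d) _

/-- The jet of a section is tangent to the vector fields `D_i`; this is the inner derivative in the
chain rule. -/
theorem pdBase_jetOf (hr : r = ∞ ∨ r = ω) (hΩ : IsOpen Ω)
    (hs : ∀ d, ∀ x ∈ Ω, ContDiffAt ℝ r (s d) x) (i : Fin n) (c : JetCoord n D) {x : Fin n → ℝ}
    (hx : x ∈ Ω) : pdBase i (fun y => jetOf s y c) x = totalStep i (jetOf s x) c := by
  rcases c with j | ⟨d, J⟩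
  · have : (fun y => jetOf s y (Sum.inl j)) = fun y : Fin n → ℝ => y j := rfl
    rw [this, pdBase, (hasFDerivAt_apply j x).fderiv]
    simp [totalStep, Pi.single_apply]
  -- `jetOf` differentiates in sorted order, and prepending `i` may break it, so commutation of
  -- partial derivatives is needed here.
  · have hperm : (i :: J.sort (· ≤ ·)).Perm ((i ::ₘ J).sort (· ≤ ·)) := by
      rw [← Multiset.coe_eq_coe, ← Multiset.cons_coe, Multiset.sort_eq, Multiset.sort_eq]
    exact pdBases_perm hr hΩ (hs d) hperm hx

theorem IsDiffFun.contDiffAt_jetOf (hr : r = ∞ ∨ r = ω) (hf : IsDiffFun r U f) (hΩ : IsOpen Ω)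
    (hs : ∀ d, ∀ x ∈ Ω, ContDiffAt ℝ r (s d) x) (hU : ∀ x ∈ Ω, jetOf s x ∈ U) {x : Fin n → ℝ}
    (hx : x ∈ Ω) : ContDiffAt ℝ r (fun y => f (jetOf s y)) x := by
  obtain ⟨-, S, k, hk⟩ := hf
  have h1 : ContDiffAt ℝ r (fun y => k (S.restrict (jetOf s y))) x :=
    ContDiffAt.comp x (f := fun y => S.restrict (jetOf s y)) (hk _ (hU x hx)).2
      (contDiffAt_pi.2 fun c => JetCalculus.contDiffAt_jetOf hr (fun d => hs d x hx) c)
  refine h1.congr_of_eventuallyEq ?_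
  filter_upwards [hΩ.mem_nhds hx] with y hy using (hk _ (hU y hy)).1

/-- Along a section, the total differentiation is the partial differentiation. -/
theorem IsDiffFun.pdBase_comp_jetOf (hr : r = ∞ ∨ r = ω) (hf : IsDiffFun r U f) (hΩ : IsOpen Ω)
    (hs : ∀ d, ∀ x ∈ Ω, ContDiffAt ℝ r (s d) x) (hU : ∀ x ∈ Ω, jetOf s x ∈ U) (i : Fin n)
    {x : Fin n → ℝ} (hx : x ∈ Ω) :
    pdBase i (fun y => f (jetOf s y)) x = JetCalculus.totalD i f (jetOf s x) := by
  obtain ⟨hUo, S, k, hk⟩ := hf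
  have hd := (hk _ (hU x hx)).2.differentiableAt (ne_zero_of_smooth hr)
  have hdj : ∀ c : S, DifferentiableAt ℝ (fun y => jetOf s y c) x := fun c =>
    (JetCalculus.contDiffAt_jetOf hr (fun d => hs d x hx) c).differentiableAt
      (ne_zero_of_smooth hr)
  have hev : (fun y => f (jetOf s y)) =ᶠ[nhds x] k ∘ fun y => S.restrict (jetOf s y) := by
    filter_upwards [hΩ.mem_nhds hx] with y hy using (hk _ (hU y hy)).1
  rw [totalD_of_rep hUo (fun p hp => (hk p hp).1) (hU x hx) hd, pdBase_congr hev, pdBase,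
    fderiv_comp (f := fun y => S.restrict (jetOf s y)) x hd (differentiableAt_pi.2 hdj)]
  refine congrArg (fderiv ℝ k (S.restrict (jetOf s x))) ?_
  have : fderiv ℝ (fun y => S.restrict (jetOf s y)) x
      = ContinuousLinearMap.pi fun c : S => fderiv ℝ (fun y => jetOf s y c) x := fderiv_pi hdj
  rw [this]
  ext c
  exact pdBase_jetOf hr hΩ hs i c hx

theorem IsDiffFun.pdBases_comp_jetOf (hr : r = ∞ ∨ r = ω) (hf : IsDiffFun r U f) (hΩ : IsOpen Ω)
    (hs : ∀ d, ∀ x ∈ Ω, ContDiffAt ℝ r (s d) x) (hU : ∀ x ∈ Ω, jetOf s x ∈ U)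
    (I : List (Fin n)) : ∀ x ∈ Ω,
    pdBases I (fun y => f (jetOf s y)) x = JetCalculus.totalDs I f (jetOf s x) := by
  induction I with
  | nil => exact fun _ _ => rfl
  | cons i I ih =>
    intro x hx
    rw [pdBases_cons, pdBase_eqOn hΩ ih i hx, totalDs_cons]
    exact (hf.totalDs hr I).pdBase_comp_jetOf hr hΩ hs hU i hx

/-- Along a section, the Euler operators become alternating sums of partial derivatives. -/
theorem IsDiffFun.euler_jetOf (hr : r = ∞ ∨ r = ω) (hf : IsDiffFun r U f) (hΩ : IsOpen Ω)
    (hs : ∀ d, ∀ x ∈ Ω, ContDiffAt ℝ r (s d) x) (hU : ∀ x ∈ Ω, jetOf s x ∈ U) {N : ℕ} {d : D}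
    (hN : ∀ J, N < Multiset.card J → ∀ p ∈ U, JetCalculus.pdJet (cu d J) f p = 0)
    (I : List (Fin n)) {x : Fin n → ℝ} (hx : x ∈ Ω) :
    JetCalculus.euler d I f (jetOf s x)
      = eulerSum N (fun J y => JetCalculus.pdJet (cu d J) f (jetOf s y) / (J.countPerms : ℝ)) I x := by
  rw [euler_eq_sum hf.1 hN I (hU x hx), eulerSum]
  refine Finset.sum_congr rfl fun K _ => ?_
  rw [← (hf.symPd hr d (I ++ K)).pdBases_comp_jetOf hr hΩ hs hU K x hx]
  rfl

end Sections

/-! ### Forgetting the second group of dependent variables -/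

section Projection

variable {n : ℕ} {D E : Type*} {r : WithTop ℕ∞}

theorem fstJet_jetOf (s : D ⊕ E → (Fin n → ℝ) → ℝ) (x : Fin n → ℝ) :
    fstJet (jetOf s x) = jetOf (fun d => s (Sum.inl d)) x := by
  funext c
  rcases c with i | ⟨d, J⟩ <;> rfl

theorem continuous_fstJet : Continuous (fstJet : Jet n (D ⊕ E) → Jet n D) := by
  refine continuous_pi fun c => ?_
  rcases c with i | ⟨d, J⟩ <;> exact continuous_apply _

theorem isDiffFun_fstJet {V : Set (Jet n (D ⊕ E))} (hV : IsOpen V) (c : JetCoord n D) :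
    IsDiffFun r V fun p => fstJet p c := by
  rcases c with i | ⟨d, J⟩ <;> exact isDiffFun_coord hV _

theorem IsDiffFun.comp_fstJet {U : Set (Jet n D)} {f : Jet n D → ℝ} (hf : IsDiffFun r U f)
    {V : Set (Jet n (D ⊕ E))} (hV : IsOpen V) (hVU : ∀ p ∈ V, fstJet p ∈ U) :
    IsDiffFun r V fun p => f (fstJet p) :=
  hf.comp hV (isDiffFun_fstJet hV) hVU

theorem fstJet_update [DecidableEq (JetCoord n D)] [DecidableEq (JetCoord n (D ⊕ E))]
    (p : Jet n (D ⊕ E)) (d : D) (J : Multiset (Fin n)) (t : ℝ) :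
    fstJet (Function.update p (cu (Sum.inl d) J) t) = Function.update (fstJet p) (cu d J) t := by
  funext c
  rcases c with i | ⟨e, K⟩
  · simp [fstJet]
  · by_cases h : (e, K) = (d, J)
    · obtain ⟨rfl, rfl⟩ := Prod.mk.inj h
      simp [fstJet]
    · have h1 : (Sum.inr (e, K) : JetCoord n D) ≠ cu d J := by simpa using h
      have h2 : (cu (Sum.inl e) K : JetCoord n (D ⊕ E)) ≠ cu (Sum.inl d) J := by simpa using h
      rw [Function.update_of_ne h1, fstJet, Function.update_of_ne h2]
      rfl

end Projection

/-! ### The formal Lagrangian -/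

section Lagrangian

variable {n m M : ℕ} {r : WithTop ℕ∞} {U : Set (Jet n (Fin m))} {F : Fin M → Jet n (Fin m) → ℝ}

theorem isDiffFun_formalLagrangian (hU : IsOpen U) (hF : ∀ β, IsDiffFun r U (F β)) :
    IsDiffFun r (fstJet ⁻¹' U) (formalLagrangian F) := by
  have hV : IsOpen (fstJet ⁻¹' U : Set (Jet n (Fin m ⊕ Fin M))) := hU.preimage continuous_fstJet
  exact IsDiffFun.sum hV fun β _ =>
    (isDiffFun_coord hV _).mul ((hF β).comp_fstJet hV fun _ h => h)

/-- Varying a `u`-coordinate leaves `v` fixed, so the factors `v^β` act as constants. This linearity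
later reduces the sum for `𝓛` to those for the `F_β`. -/
theorem pdJet_formalLagrangian (hr : r = ∞ ∨ r = ω) (hF : ∀ β, IsDiffFun r U (F β))
    {p : Jet n (Fin m ⊕ Fin M)} (hp : fstJet p ∈ U) (α : Fin m) (J : Multiset (Fin n)) :
    pdJet (cu (Sum.inl α) J) (formalLagrangian F) p
      = ∑ β, p (cu (Sum.inr β) 0) * pdJet (cu α J) (F β) (fstJet p) := by
  classical
  have h : HasDerivAt (fun t : ℝ => ∑ β, p (cu (Sum.inr β) 0)
      * F β (Function.update (fstJet p) (cu α J) t))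
      (∑ β, p (cu (Sum.inr β) 0) * pdJet (cu α J) (F β) (fstJet p))
      (p (cu (Sum.inl α) J)) := by
    refine HasDerivAt.fun_sum fun β _ => HasDerivAt.const_mul _ ?_
    exact (hF β).hasDerivAt_update hr hp (cu α J)
  rw [← h.deriv, pdJet_eq_deriv]
  refine congrArg (fun g => deriv g _) (funext fun t => ?_)
  rw [formalLagrangian]
  refine Finset.sum_congr rfl fun β _ => ?_
  rw [fstJet_update, Function.update_of_ne (by simp)]

end Lagrangian

/-! ### The substitution `v = φ(x, u)` -/

section Substitution

variable {n m M : ℕ} {r : WithTop ℕ∞} {U : Set (Jet n (Fin m))}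
  {φ : Fin M → (Fin n → ℝ) × (Fin m → ℝ) → ℝ}

theorem isDiffFun_pointFun (hU : IsOpen U) {ψ : (Fin n → ℝ) × (Fin m → ℝ) → ℝ}
    (hψ : ∀ p ∈ U, ContDiffAt ℝ r ψ (fun i => p (cx i), fun α => p (cu α 0))) :
    IsDiffFun r U (pointFun ψ) := by
  have := IsDiffFun.comp_finite (r := r) hU
    (f := fun (c : Fin n ⊕ Fin m) p => p (Sum.elim cx (fun α => cu α 0) c))
    (fun c => isDiffFun_coord hU _) (h := fun y => ψ (fun i => y (Sum.inl i), fun α => y (Sum.inr α)))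
    fun p hp => ContDiffAt.comp _
      (f := fun y : Fin n ⊕ Fin m → ℝ => (fun i => y (Sum.inl i), fun α => y (Sum.inr α)))
      (hψ p hp) ((contDiffAt_pi.2 fun i => contDiffAt_apply _ _ _ _).prodMk
        (contDiffAt_pi.2 fun α => contDiffAt_apply _ _ _ _))
  exact this

theorem fstJet_substJet (p : Jet n (Fin m)) : fstJet (substJet φ p) = p := by
  funext c
  rcases c with i | ⟨d, J⟩ <;> rfl

theorem IsDiffFun.elimV (hr : r = ∞ ∨ r = ω) (hU : IsOpen U)
    (hφ : ∀ β, IsDiffFun r U (pointFun (φ β))) {f : Jet n (Fin m ⊕ Fin M) → ℝ}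
    (hf : IsDiffFun r (fstJet ⁻¹' U) f) : IsDiffFun r U (elimV φ f) := by
  refine hf.comp hU (fun c => ?_) fun p hp => ?_
  · rcases c with i | ⟨α | β, J⟩
    · exact isDiffFun_coord hU _
    · exact isDiffFun_coord hU _
    · exact (hφ β).totalDs hr _
  · rwa [Set.mem_preimage, fstJet_substJet]

/-- The jets of the functions `u` and `φ(x, u)` are obtained by the substitution. -/
theorem substJet_jetOf (hr : r = ∞ ∨ r = ω) (hφ : ∀ β, IsDiffFun r U (pointFun (φ β)))
    {Ω : Set (Fin n → ℝ)} (hΩ : IsOpen Ω) {u : Fin m → (Fin n → ℝ) → ℝ}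
    (hu : ∀ α, ∀ x ∈ Ω, ContDiffAt ℝ r (u α) x) (hU : ∀ x ∈ Ω, jetOf u x ∈ U) {x : Fin n → ℝ}
    (hx : x ∈ Ω) : substJet φ (jetOf u x)
      = jetOf (Sum.elim u fun β y => pointFun (φ β) (jetOf u y)) x := by
  funext c
  rcases c with i | ⟨α | β, J⟩
  · rfl
  · rfl
  · exact ((hφ β).pdBases_comp_jetOf hr hΩ hu hU _ x hx).symm

end Substitution

/-! ### Prolonged symmetries and the conserved vector -/

section Symmetry

variable {n m M : ℕ} {κ : Type*} {r : WithTop ℕ∞} {U : Set (Jet n (Fin m))}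
  {V : Set (Jet n (Fin m ⊕ κ))} {F : Fin M → Jet n (Fin m) → ℝ}
  {φ : Fin M → (Fin n → ℝ) × (Fin m → ℝ) → ℝ}
  {ξ : Fin n → Jet n (Fin m ⊕ κ) → ℝ} {η : Fin m → Jet n (Fin m ⊕ κ) → ℝ}

theorem isDiffFun_charW (hV : IsOpen V) (hξ : ∀ i, IsDiffFun r V (ξ i))
    (hη : ∀ α, IsDiffFun r V (η α)) (α : Fin m) : IsDiffFun r V (charW ξ η α) :=
  (hη α).sub (IsDiffFun.sum hV fun i _ => (hξ i).mul (isDiffFun_coord hV _))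

/-- The total differentiation in terms of the symmetric derivatives. -/
theorem totalD_eq_sum_symPd (hr : r = ∞ ∨ r = ω) {f : Jet n (Fin m) → ℝ} (hf : IsDiffFun r U f)
    {N : ℕ} (hN : ∀ α J, N < Multiset.card J → ∀ p ∈ U, pdJet (cu α J) f p = 0)
    {p : Jet n (Fin m)} (hp : p ∈ U) (i : Fin n) :
    totalD i f p = pdJet (cx i) f p + ∑ α, ∑ I ∈ listsUpTo n N,
      p (cu α (i ::ₘ (I : Multiset (Fin n)))) * symPd α I f p := by
  rw [totalD, finsum_curry, finsum_eq_sum_of_fintype]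
  · congr 1
    refine Finset.sum_congr rfl fun α _ => ?_
    rw [← sum_div_countPerms (N := N) (h := fun J => p (cu α (i ::ₘ J)) * pdJet (cu α J) f p)]
    · exact Finset.sum_congr rfl fun I _ => by rw [symPd, mul_div_assoc]
    · intro J hJ
      rw [hN α J hJ p hp, mul_zero]
  · exact (hf.finite_support_pdJet hr hp).subset fun c hc h => hc (by simp only [h, mul_zero])

/-- The terms `ξ^j u^α_{jI}` of the prolongation coefficients combine with `ξ^j ∂/∂x^j` into `ξ^j
D_j`. What is left is the evolutionary part, with coefficients `D_I(W^α)`. -/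
theorem prolong_eq (hr : r = ∞ ∨ r = ω) {f : Jet n (Fin m) → ℝ} (hf : IsDiffFun r U f)
    {N : ℕ} (hN : ∀ α J, N < Multiset.card J → ∀ p ∈ U, pdJet (cu α J) f p = 0)
    {p : Jet n (Fin m ⊕ κ)} (hp : fstJet p ∈ U) :
    prolong ξ η f p = ∑ i, ξ i p * totalD i f (fstJet p) +
      ∑ α, ∑ I ∈ listsUpTo n N, totalDs I (charW ξ η α) p * symPd α I f (fstJet p) := by
  have hfin : ∀ α, (∑ᶠ I : List (Fin n), (totalDs I (charW ξ η α) p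
      + ∑ j, ξ j p * p (cu (Sum.inl α) (j ::ₘ (I : Multiset (Fin n))))) * symPd α I f (fstJet p))
      = ∑ I ∈ listsUpTo n N, totalDs I (charW ξ η α) p * symPd α I f (fstJet p)
        + ∑ j, ξ j p * ∑ I ∈ listsUpTo n N,
          fstJet p (cu α (j ::ₘ (I : Multiset (Fin n)))) * symPd α I f (fstJet p) := by
    intro α
    rw [finsum_list_eq_sum (N := N)]
    · simp only [add_mul, Finset.sum_add_distrib, Finset.sum_mul, Finset.mul_sum]
      rw [Finset.sum_comm (s := Finset.univ)]
      congr 1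
      refine Finset.sum_congr rfl fun I _ => Finset.sum_congr rfl fun j _ => ?_
      rw [mul_assoc]
      rfl
    · intro I hI
      rw [symPd, hN α _ (by simpa using hI) _ hp, zero_div, mul_zero]
  simp only [prolong, hfin, totalD_eq_sum_symPd hr hf hN hp, mul_add, Finset.sum_add_distrib]
  have : ∑ i, ξ i p * ∑ α, ∑ I ∈ listsUpTo n N,
        fstJet p (cu α (i ::ₘ (I : Multiset (Fin n)))) * symPd α I f (fstJet p)
      = ∑ α, ∑ i, ξ i p * ∑ I ∈ listsUpTo n N,
        fstJet p (cu α (i ::ₘ (I : Multiset (Fin n)))) * symPd α I f (fstJet p) := by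
    rw [Finset.sum_comm]
    exact Finset.sum_congr rfl fun i _ => Finset.mul_sum _ _ _
  rw [this]
  ring

/-- The Euler operator for `i :: J` vanishes once `J` is longer than `N`, so the bound on the order
of `𝓛` also bounds the sum over `J`. -/
theorem conservedVector_eq (hU : IsOpen U) {N : ℕ} (hN : ∀ α J, N < Multiset.card J →
      ∀ p ∈ (fstJet ⁻¹' U : Set (Jet n (Fin m ⊕ Fin M))),
        pdJet (cu (Sum.inl α) J) (formalLagrangian F) p = 0)
    (i : Fin n) {p : Jet n (Fin m ⊕ κ)} (hp : fstJet p ∈ U) :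
    conservedVector F φ ξ η i p = ξ i p * elimV φ (formalLagrangian F) (fstJet p) +
      ∑ α, ∑ J ∈ listsUpTo n N, totalDs J (charW ξ η α) p *
        elimV φ (euler (Sum.inl α) (i :: J) (formalLagrangian F)) (fstJet p) := by
  rw [conservedVector]
  congr 1
  refine Finset.sum_congr rfl fun α _ => finsum_list_eq_sum fun J hJ => ?_
  rw [elimV, euler_eq_zero (hU.preimage continuous_fstJet) (hN α)
    (by rw [List.length_cons]; omega), mul_zero]
  rwa [Set.mem_preimage, fstJet_substJet]

theorem isDiffFun_conservedVector (hr : r = ∞ ∨ r = ω) (hU : IsOpen U) (hV : IsOpen V)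
    (hVU : ∀ p ∈ V, fstJet p ∈ U) (hF : ∀ β, IsDiffFun r U (F β))
    (hφ : ∀ β, IsDiffFun r U (pointFun (φ β))) (hξ : ∀ i, IsDiffFun r V (ξ i))
    (hη : ∀ α, IsDiffFun r V (η α)) {N : ℕ} (hN : ∀ α J, N < Multiset.card J →
      ∀ p ∈ (fstJet ⁻¹' U : Set (Jet n (Fin m ⊕ Fin M))),
        pdJet (cu (Sum.inl α) J) (formalLagrangian F) p = 0) (i : Fin n) :
    IsDiffFun r V (conservedVector F φ ξ η i) := by
  have hL := isDiffFun_formalLagrangian hU hF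
  refine IsDiffFun.congr (IsDiffFun.add ((hξ i).mul ((hL.elimV hr hU hφ).comp_fstJet hV hVU)) ?_)
    fun p hp => conservedVector_eq hU hN i (hVU p hp)
  exact IsDiffFun.sum hV fun α _ => IsDiffFun.sum hV fun J _ =>
    ((isDiffFun_charW hV hξ hη α).totalDs hr J).mul
      (((hL.euler hr (hN α) _).elimV hr hU hφ).comp_fstJet hV hVU)

end Symmetry

end JetCalculus

/-- The nonlocal variables `w^k`, `k ∈ κ`, are defined by the differential equations `G_b = 0`. With
`κ` and `ι` empty, `X` is an arbitrary Lie–Bäcklund symmetry, in particular a Lie point or a contact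
symmetry; in general `X` is a nonlocal symmetry. -/
theorem theorem13p2 {n m M : ℕ} {κ ι : Type*} (r : WithTop ℕ∞) (hr : r = ∞ ∨ r = ω)
    (U : Set (Jet n (Fin m))) (F : Fin M → Jet n (Fin m) → ℝ)
    (hF : ∀ β, IsDiffFun r U (F β))
    (φ : Fin M → (Fin n → ℝ) × (Fin m → ℝ) → ℝ)
    (hφ : IsNonlinearlySelfAdjoint r U F φ)
    (V : Set (Jet n (Fin m ⊕ κ))) (hV : ∀ p ∈ V, fstJet p ∈ U)
    (G : ι → Jet n (Fin m ⊕ κ) → ℝ) (hG : ∀ b, IsDiffFun r V (G b))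
    (ξ : Fin n → Jet n (Fin m ⊕ κ) → ℝ) (hξ : ∀ i, IsDiffFun r V (ξ i))
    (η : Fin m → Jet n (Fin m ⊕ κ) → ℝ) (hη : ∀ α, IsDiffFun r V (η α))
    (hX : IsSymmetry r F V G ξ η) :
    IsConservedVector r F V G (conservedVector F φ ξ η) := by
  -- Nontriviality of `φ` supplies an equation index, and `F β₀` being a differential function
  -- carries the openness of `U`.
  obtain ⟨-, -, β₀, -⟩ := hφ.nontrivial
  have hU : IsOpen U := (hF β₀).1
  have hφd : ∀ β, IsDiffFun r U (pointFun (φ β)) :=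
    fun β => isDiffFun_pointFun hU fun p hp => hφ.smooth p hp β
  choose N' hN' using fun β => (hF β).exists_order hr
  obtain ⟨N, hNF⟩ : ∃ N : ℕ, ∀ β α J, N < Multiset.card J → ∀ p ∈ U,
      pdJet (cu α J) (F β) p = 0 :=
    ⟨Finset.univ.sup N', fun β α J hJ =>
      hN' β α J ((Finset.le_sup (Finset.mem_univ β)).trans_lt hJ)⟩
  have hNL : ∀ α J, N < Multiset.card J →
      ∀ p ∈ (fstJet ⁻¹' U : Set (Jet n (Fin m ⊕ Fin M))),
        pdJet (cu (Sum.inl α) J) (formalLagrangian F) p = 0 := by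
    intro α J hJ p hp
    rw [pdJet_formalLagrangian hr hF hp]
    exact Finset.sum_eq_zero fun β _ => by rw [hNF β α J hJ _ hp, mul_zero]
  have hL := isDiffFun_formalLagrangian hU hF
  have hC : ∀ i, IsDiffFun r V (conservedVector F φ ξ η i) := fun i =>
    isDiffFun_conservedVector hr hU (hξ i).1 hV hF hφd hξ hη hNL i
  refine ⟨hC, fun Ω s hs x hx => ?_⟩
  have hΩ := hs.1
  have hsm : ∀ d, ∀ y ∈ Ω, ContDiffAt ℝ r (s d) y :=
    fun d y hy => (hs.2.1 d).contDiffAt (hΩ.mem_nhds hy)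
  have hsV : ∀ y ∈ Ω, jetOf s y ∈ V := fun y hy => (hs.2.2 y hy).1
  set u : Fin m → (Fin n → ℝ) → ℝ := fun α => s (Sum.inl α) with hu
  have hum : ∀ α, ∀ y ∈ Ω, ContDiffAt ℝ r (u α) y := fun α => hsm _
  have hfst : ∀ y, fstJet (jetOf s y) = jetOf u y := fstJet_jetOf s
  have huU : ∀ y ∈ Ω, jetOf u y ∈ U := fun y hy => hfst y ▸ hV _ (hsV y hy)
  have hFu : ∀ β, ∀ y ∈ Ω, F β (jetOf u y) = 0 := fun β y hy => by
    have := (hs.2.2 y hy).2 (Sum.inl β)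
    rwa [jointSystem, Sum.elim_inl, hfst] at this
  have husol : IsSolution r U F Ω u :=
    ⟨hΩ, fun α => hs.2.1 _, fun y hy => ⟨huU y hy, fun β => hFu β y hy⟩⟩
  -- the functions `u` together with `v = φ(x, u)`
  set v : Fin m ⊕ Fin M → (Fin n → ℝ) → ℝ :=
    Sum.elim u fun β y => pointFun (φ β) (jetOf u y) with hv
  have hsub : ∀ y ∈ Ω, substJet φ (jetOf u y) = jetOf v y :=
    fun y hy => substJet_jetOf hr hφd hΩ hum huU hy
  have hvm : ∀ d, ∀ y ∈ Ω, ContDiffAt ℝ r (v d) y := by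
    rintro (α | β) y hy
    · exact hum α y hy
    · exact (hφd β).contDiffAt_jetOf hr hΩ hum huU hy
  have hvU : ∀ y ∈ Ω, jetOf v y ∈ fstJet ⁻¹' U := fun y hy => by
    rw [← hsub y hy, Set.mem_preimage, fstJet_substJet]
    exact huU y hy
  set w : Fin m → (Fin n → ℝ) → ℝ := fun α y => charW ξ η α (jetOf s y) with hw
  set P : Fin m → Multiset (Fin n) → (Fin n → ℝ) → ℝ := fun α J y =>
    pdJet (cu (Sum.inl α) J) (formalLagrangian F) (jetOf v y) / (J.countPerms : ℝ) with hPdef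
  have hPm : ∀ α J, ∀ y ∈ Ω, ContDiffAt ℝ r (P α J) y := fun α J y hy =>
    ((hL.pdJet hr _).contDiffAt_jetOf hr hΩ hvm hvU hy).div_const _
  have hPN : ∀ α J, N < Multiset.card J → ∀ y ∈ Ω, P α J y = 0 := fun α J hJ y hy => by
    simp only [hPdef, hNL α J hJ _ (hvU y hy), zero_div]
  have hE : ∀ α I, ∀ y ∈ Ω, elimV φ (euler (Sum.inl α) I (formalLagrangian F)) (jetOf u y)
      = eulerSum N (P α) (I : Multiset (Fin n)) y := fun α I y hy => by
    rw [elimV, hsub y hy]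
    exact hL.euler_jetOf hr hΩ hvm hvU (hNL α) I hy
  -- Without independent variables the divergence is an empty sum; otherwise `ξ i₀` carries the
  -- openness of `V`.
  rcases isEmpty_or_nonempty (Fin n) with hn | ⟨⟨i₀⟩⟩
  · simp
  have hVo : IsOpen V := (hξ i₀).1
  have hWd := isDiffFun_charW hVo hξ hη
  have hwm : ∀ α, ∀ y ∈ Ω, ContDiffAt ℝ r (w α) y :=
    fun α y hy => (hWd α).contDiffAt_jetOf hr hΩ hsm hsV hy
  -- The identity is proved on all of `Ω` so that it can be differentiated. The term `ξ^i 𝓛` drops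
  -- out because every `F_β` vanishes along the solution.
  have hcv : ∀ i, ∀ y ∈ Ω, conservedVector F φ ξ η i (jetOf s y)
      = ∑ α, ∑ J ∈ listsUpTo n N, pdBases J (w α) y
          * eulerSum N (P α) (i ::ₘ (J : Multiset (Fin n))) y := by
    intro i y hy
    have hl : elimV φ (formalLagrangian F) (jetOf u y) = 0 := by
      rw [elimV, formalLagrangian]
      exact Finset.sum_eq_zero fun β _ => by rw [fstJet_substJet, hFu β y hy, mul_zero]
    rw [conservedVector_eq hU hNL i (hV _ (hsV y hy)), hfst, hl, mul_zero, zero_add]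
    refine Finset.sum_congr rfl fun α _ => Finset.sum_congr rfl fun J _ => ?_
    rw [hE α _ y hy, (hWd α).pdBases_comp_jetOf hr hΩ hsm hsV J y hy, Multiset.cons_coe]
  have hdiv : ∑ i, totalD i (conservedVector F φ ξ η i) (jetOf s x)
      = ∑ α, ∑ i, pdBase i (fun y => ∑ J ∈ listsUpTo n N, pdBases J (w α) y
          * eulerSum N (P α) (i ::ₘ (J : Multiset (Fin n))) y) x := by
    rw [Finset.sum_comm]
    refine Finset.sum_congr rfl fun i _ => ?_
    rw [← (hC i).pdBase_comp_jetOf hr hΩ hsm hsV i hx, pdBase_eqOn hΩ (hcv i) i hx]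
    refine pdBase_sum (fun α _ => ?_) i
    refine ContDiffAt.differentiableAt (ContDiffAt.sum fun J _ => ?_) (ne_zero_of_smooth hr)
    exact (contDiffAt_pdBases hr (hwm α x hx) J).mul
      (contDiffAt_eulerSum hr (fun J => hPm α J x hx) _)
  have hadj : ∀ α, eulerSum N (P α) 0 x = 0 := fun α => by
    have := hφ.adjoint Ω u husol x hx α
    rwa [hE α [] x hx] at this
  have hsym : ∀ β, ∑ α, ∑ I ∈ listsUpTo n N,
      pdBases I (w α) x * symPd α I (F β) (jetOf u x) = 0 := by
    intro β
    have h := hX Ω s hs x hx β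
    rw [prolong_eq hr (hF β) (hNF β) (hV _ (hsV x hx)), hfst] at h
    -- `F β` vanishes along `u` on the whole open set `Ω`, hence so do its derivatives; this removes
    -- `ξ^i D_i(F_β)` from `X(F_β)`.
    have h0 : ∀ i, totalD i (F β) (jetOf u x) = 0 := fun i => by
      rw [← (hF β).pdBase_comp_jetOf hr hΩ hum huU i hx]
      have := pdBase_eqOn hΩ (g := fun _ => 0) (hFu β) i hx
      rwa [pdBase_const] at this
    simp only [h0, mul_zero, Finset.sum_const_zero, zero_add] at h
    rw [← h]
    refine Finset.sum_congr rfl fun α _ => Finset.sum_congr rfl fun I _ => ?_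
    rw [(hWd α).pdBases_comp_jetOf hr hΩ hsm hsV I x hx]
  have hP : ∀ α (I : List (Fin n)), P α I x
      = ∑ β, jetOf v x (cu (Sum.inr β) 0) * symPd α I (F β) (jetOf u x) := fun α I => by
    have hq : fstJet (jetOf v x) = jetOf u x := by rw [← hsub x hx, fstJet_substJet]
    simp only [hPdef]
    rw [pdJet_formalLagrangian hr hF (hvU x hx), Finset.sum_div, hq]
    exact Finset.sum_congr rfl fun β _ => mul_div_assoc _ _ _
  rw [hdiv]
  calc _ = ∑ α, ∑ I ∈ listsUpTo n N, pdBases I (w α) x * P α I x :=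
        Finset.sum_congr rfl fun α _ => by
          rw [sum_pdBase_sum_eulerSum hr hΩ (hwm α) (hPm α) (hPN α) x hx, hadj, mul_zero, sub_zero]
    -- The values `v^β = φ^β(x,u)` depend on neither `α` nor `I`, so they factor out and leave the
    -- symmetry condition for each single equation.
    _ = ∑ β : Fin M, jetOf v x (cu (Sum.inr β) 0) * ∑ α, ∑ I ∈ listsUpTo n N,
          pdBases I (w α) x * symPd α I (F β) (jetOf u x) := by
        simp only [hP, Finset.mul_sum]
        rw [Finset.sum_comm (s := Finset.univ (α := Fin M))]
        refine Finset.sum_congr rfl fun α _ => ?_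
        rw [Finset.sum_comm]
        exact Finset.sum_congr rfl fun β _ => Finset.sum_congr rfl fun I _ => mul_left_comm _ _ _
    _ = 0 := Finset.sum_eq_zero fun β _ => by rw [hsym, mul_zero]
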